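/- Let $\mathcal X$ be the data space (a subset of a measurable space), $\mathcal C\subset\mathbb R^l$ the set of domain labels and $\mathcal Z\subset\mathbb R^k$ the latent space. Let $(X,C)$ be a random pair with values in $\mathcal X\times\mathcal C$, and let $(\mathbb P_{X|C}(\cdot|c))_{c}$ be a fixed regular conditional distribution of $X$ given $C$ (a Markov kernel), where $\mathbb P_{X|C}(\cdot|c)$ is a probability measure carried by $\mathcal X$ for every $c\in\mathcal C$. Let $\mathrm{Enc}:\mathcal X\times\mathcal C\to\mathcal Z$ (encoder) and $\mathrm{Gen}:\mathcal Z\times\mathcal C\to\mathcal X$ (generator) be measurable, let $T:\mathcal X\times\mathcal C^2\to\mathcal X$ (transport map), and let $p\in[1,\infty)$. Write $\mathbb P_{\mathrm{Enc}(X,C)|C}(\cdot|c)$ for the image of $\mathbb P_{X|C}(\cdot|c)$ under $\mathrm{Enc}(\cdot,c)$, write $\mathbb P_{(X,C)|C}(\cdot|c)$ for its image under $x\mapsto(x,c)$, and put $d_{\mathrm{Enc}}((x_1,c_1),(x_2,c_2)):=\lVert(\mathrm{Enc}(x_1,c_1),c_1)-(\mathrm{Enc}(x_2,c_2),c_2)\rVert$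 with the Euclidean norm of $\mathbb R^{k+l}$. Let $c_1,\dots,c_M\in\mathcal C$ ($M\ge1$) be observed domain labels, let $\alpha_1,\dots,\alpha_M\ge0$ with $\sum_m\alpha_m=1$, and suppose that $\bar c:=\sum_{m=1}^M\alpha_mc_m\in\mathcal C$. Assume: (A1) for all $c\in\mathcal C$, $x\in\mathcal X$, $z\in\mathcal Z$: $\mathrm{Gen}(\mathrm{Enc}(x,c),c)=x$ and $\mathrm{Enc}(\mathrm{Gen}(z,c),c)=z$; (A2) for every $c\in\mathcal C$, $\mathbb P_{\mathrm{Enc}(X,C)|C}(\cdot|c)$ is absolutely continuous with respect to Lebesgue measure, is carried by a compact set, and has finite second moments; (A3) for all observed labels $c_m,c_{m'}$, the map $(x,c_m)\mapsto(T(x,c_m,c_{m'}),c_{m'})$ is an optimal transport map from $\mathbb P_{(X,C)|C}(\cdot|c_m)$ to $\mathbb P_{(X,C)|C}(\cdot|c_{m'})$ with respect to the cost $d_{\mathrm{Enc}}^p$, that is, it pushes the first measure forward to the second and minimizes the integrated cost among all maps that do so; (A4) $\mathbb P_{\mathrm{Enc}(X,C)|C}(\cdot|c_m)=\mathbb P_{\mathrm{Enc}(X,C)|C}(\cdot|c_{m'})$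 for all observed labels $c_m,c_{m'}$; (A5) $\mathbb P_{\mathrm{Enc}(X,C)|C}(\cdot|c)$ does not depend on $c\in\mathcal C$ (so that $\mathrm{Enc}(X,C)$ is independent of $C$). Let $X_1$ be a random variable with law $\mathbb P_{X|C}(\cdot|c_1)$, and let $$\tilde X(\alpha_1,\dots,\alpha_M):=\mathrm{Gen}\Big(\sum_{m=1}^M\alpha_m\,\mathrm{Enc}(T(X_1,c_1,c_m),c_m),\ \bar c\Big)$$ be the latent interpolation (if $\mathcal Z$ is not convex, extend $\mathrm{Gen}(\cdot,\bar c)$ to $\mathbb R^k$ measurably in any way). Then the law of $\tilde X(\alpha_1,\dots,\alpha_M)$ is $\mathbb P_{X|C}(\cdot|\bar c)$. -/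

import Mathlib

open MeasureTheory ProbabilityTheory
open scoped ENNReal

noncomputable section

namespace GeodesicGenerator

/-! Data take values in a set `𝒳` of a measurable space `E`, domain labels in a set `𝒞` of a
Euclidean space `ℝˡ`, and representations in a set `𝒵` of a Euclidean space `ℝᵏ`.  The maps
`Enc : 𝒳 × 𝒞 → 𝒵`, `Gen : 𝒵 × 𝒞 → 𝒳` and `T : 𝒳 × 𝒞² → 𝒳` are written as curried functions on
the ambient spaces; only their values on the sets above are constrained.  `κ c` is the
conditional law of the data given the label `c`. -/

/-- `κ` is a regular conditional distribution of the data `X` given the label `C`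
under the probability measure `P`, living on the data set `𝒳` for every label of `𝒞`. -/
structure IsConditionalLaw {Ω E : Type*} [MeasurableSpace Ω] [MeasurableSpace E] {l : ℕ}
    (P : Measure Ω) (X : Ω → E) (C : Ω → EuclideanSpace ℝ (Fin l))
    (𝒳 : Set E) (𝒞 : Set (EuclideanSpace ℝ (Fin l)))
    (κ : Kernel (EuclideanSpace ℝ (Fin l)) E) : Prop where
  /-- The joint law of `(C, X)` is `P_C ⊗ κ`. -/
  hasCondDistrib : HasCondDistrib X C κ P
  /-- Labels lie in `𝒞`. -/
  label_mem : ∀ᵐ ω ∂P, C ω ∈ 𝒞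
  /-- Every conditional law is carried by `𝒳`. -/
  data_mem : ∀ c ∈ 𝒞, ∀ᵐ x ∂(κ c), x ∈ 𝒳

/-- The map `S` is an optimal transport map from `μ` to `ν` for the cost `cost`: it pushes `μ`
forward to `ν`, and it has the least transport cost among all maps doing so. -/
def IsOptimalTransportMap {A B : Type*} [MeasurableSpace A] [MeasurableSpace B]
    (cost : A → B → ℝ≥0∞) (μ : Measure A) (ν : Measure B) (S : A → B) : Prop :=
  HasLaw S ν μ ∧
    ∀ R : A → B, HasLaw R ν μ → ∫⁻ a, cost a (S a) ∂μ ≤ ∫⁻ a, cost a (R a) ∂μ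

section

variable {E : Type*} {k l : ℕ}

/-- `d_Enc((x₁, c₁), (x₂, c₂)) = ‖(Enc(x₁, c₁), c₁) - (Enc(x₂, c₂), c₂)‖`, with the Euclidean
norm of `ℝᵏ × ℝˡ`. -/
def dEnc (Enc : E → EuclideanSpace ℝ (Fin l) → EuclideanSpace ℝ (Fin k))
    (q q' : E × EuclideanSpace ℝ (Fin l)) : ℝ :=
  ‖WithLp.toLp 2 (Enc q.1 q.2, q.2) - WithLp.toLp 2 (Enc q'.1 q'.2, q'.2)‖

/-- Condition (A1): for every label, `Enc` and `Gen` are mutually inverse between `𝒳` and `𝒵`. -/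
structure OneToOne (𝒳 : Set E) (𝒵 : Set (EuclideanSpace ℝ (Fin k)))
    (𝒞 : Set (EuclideanSpace ℝ (Fin l)))
    (Enc : E → EuclideanSpace ℝ (Fin l) → EuclideanSpace ℝ (Fin k))
    (Gen : EuclideanSpace ℝ (Fin k) → EuclideanSpace ℝ (Fin l) → E) : Prop where
  enc_mem : ∀ c ∈ 𝒞, ∀ x ∈ 𝒳, Enc x c ∈ 𝒵
  gen_mem : ∀ c ∈ 𝒞, ∀ z ∈ 𝒵, Gen z c ∈ 𝒳
  gen_enc : ∀ c ∈ 𝒞, ∀ x ∈ 𝒳, Gen (Enc x c) c = x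
  enc_gen : ∀ c ∈ 𝒞, ∀ z ∈ 𝒵, Enc (Gen z c) c = z

variable [MeasurableSpace E]

/-- The law of `Enc(X, C)` given `C = c`. -/
def encLaw (Enc : E → EuclideanSpace ℝ (Fin l) → EuclideanSpace ℝ (Fin k))
    (κ : Kernel (EuclideanSpace ℝ (Fin l)) E) (c : EuclideanSpace ℝ (Fin l)) :
    Measure (EuclideanSpace ℝ (Fin k)) :=
  (κ c).map (fun x => Enc x c)

/-- The law of `(X, C)` given `C = c`, that is, of `(X, c)` given `C = c`. -/
def jointLaw (κ : Kernel (EuclideanSpace ℝ (Fin l)) E) (c : EuclideanSpace ℝ (Fin l)) :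
    Measure (E × EuclideanSpace ℝ (Fin l)) :=
  (κ c).map (fun x => (x, c))

/-- Condition (A2): for every label the law of the representation is absolutely continuous
(with respect to Lebesgue measure), carried by a compact set, and has finite second moments. -/
def AbsolutelyContinuousRepresentations (𝒞 : Set (EuclideanSpace ℝ (Fin l)))
    (Enc : E → EuclideanSpace ℝ (Fin l) → EuclideanSpace ℝ (Fin k))
    (κ : Kernel (EuclideanSpace ℝ (Fin l)) E) : Prop :=
  ∀ c ∈ 𝒞, encLaw Enc κ c ≪ volume ∧
    (∃ K : Set (EuclideanSpace ℝ (Fin k)), IsCompact K ∧ ∀ᵐ z ∂(encLaw Enc κ c), z ∈ K) ∧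
    MemLp (fun z : EuclideanSpace ℝ (Fin k) => z) 2 (encLaw Enc κ c)

/-- Condition (A3): for any two observed labels `c m` and `c m'`, the map
`(T(·, ·, c m'), c m')` is an optimal transport map, for the `p`-th power of `d_Enc`, from the law
of `(X, C)` given `C = c m` to the law of `(X, C)` given `C = c m'`. -/
def OptimalTransportation {M : ℕ} (p : ℝ) (c : Fin M → EuclideanSpace ℝ (Fin l))
    (Enc : E → EuclideanSpace ℝ (Fin l) → EuclideanSpace ℝ (Fin k))
    (T : E → EuclideanSpace ℝ (Fin l) → EuclideanSpace ℝ (Fin l) → E)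
    (κ : Kernel (EuclideanSpace ℝ (Fin l)) E) : Prop :=
  ∀ m m' : Fin M, IsOptimalTransportMap (fun q q' => ENNReal.ofReal (dEnc Enc q q' ^ p))
    (jointLaw κ (c m)) (jointLaw κ (c m')) (fun q => (T q.1 q.2 (c m'), c m'))

/-- Condition (A4): the law of the representation is the same for all observed labels. -/
def HomogeneousOnObserved {M : ℕ} (c : Fin M → EuclideanSpace ℝ (Fin l))
    (Enc : E → EuclideanSpace ℝ (Fin l) → EuclideanSpace ℝ (Fin k))
    (κ : Kernel (EuclideanSpace ℝ (Fin l)) E) : Prop :=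
  ∀ m m' : Fin M, encLaw Enc κ (c m) = encLaw Enc κ (c m')

/-- Condition (A5): the law of the representation given `C = c` is constant in `c ∈ 𝒞`
(independence of `Enc(X, C)` and `C`, read for the given version of the conditional laws). -/
def Homogeneous (𝒞 : Set (EuclideanSpace ℝ (Fin l)))
    (Enc : E → EuclideanSpace ℝ (Fin l) → EuclideanSpace ℝ (Fin k))
    (κ : Kernel (EuclideanSpace ℝ (Fin l)) E) : Prop :=
  ∀ c ∈ 𝒞, ∀ c' ∈ 𝒞, encLaw Enc κ c = encLaw Enc κ c'

/-- The latent interpolation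
`X̃(α₁, …, α_M) = Gen(∑ₘ αₘ Enc(T(X₁, c₁, cₘ), cₘ), ∑ₘ αₘ cₘ)` of the point `X₁ = x`.
The first label `c₁` is `c 0`. -/
def latentInterpolation {M : ℕ} [NeZero M] (α : Fin M → ℝ)
    (c : Fin M → EuclideanSpace ℝ (Fin l))
    (Enc : E → EuclideanSpace ℝ (Fin l) → EuclideanSpace ℝ (Fin k))
    (Gen : EuclideanSpace ℝ (Fin k) → EuclideanSpace ℝ (Fin l) → E)
    (T : E → EuclideanSpace ℝ (Fin l) → EuclideanSpace ℝ (Fin l) → E) (x : E) : E :=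
  Gen (∑ m, α m • Enc (T x (c 0) (c m)) (c m)) (∑ m, α m • c m)

end

end GeodesicGenerator

end

/-! The proof compares the transport map with one explicit competitor. Since `Enc` and `Gen` are
mutually inverse, the hypothesis that all conditional laws of the representation agree makes the
re-labelling map `x ↦ Gen (Enc x c) c'` push the law of the data given `c` forward to the law given
`c'` (`hasLaw_gen_enc`). This map leaves the representation unchanged, so it costs only
`‖c - c'‖ ^ p`. No map costs less at any point, because
`dEnc ((x, c), (y, c')) ^ 2 = ‖Enc x c - Enc y c'‖ ^ 2 + ‖c - c'‖ ^ 2`, and equality at a point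
forces the two representations to be equal. An optimal map therefore preserves the representation
almost surely (`ae_enc_transport_eq`). The latent interpolation is then almost surely
`Gen (Enc X₁ c₁) (∑ αₘ cₘ)`, another re-labelling, whose law is the claimed one. Existence and
uniqueness theory for optimal transport is never needed. -/

namespace GeodesicGenerator

variable {E : Type*} {k l : ℕ}
  {Enc : E → EuclideanSpace ℝ (Fin l) → EuclideanSpace ℝ (Fin k)}
  {Gen : EuclideanSpace ℝ (Fin k) → EuclideanSpace ℝ (Fin l) → E}

lemma dEnc_sq (q q' : E × EuclideanSpace ℝ (Fin l)) :
    dEnc Enc q q' ^ 2 = ‖Enc q.1 q.2 - Enc q'.1 q'.2‖ ^ 2 + ‖q.2 - q'.2‖ ^ 2 := by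
  rw [dEnc, WithLp.prod_norm_sq_eq_of_L2]
  rfl

lemma norm_label_sub_le_dEnc (q q' : E × EuclideanSpace ℝ (Fin l)) :
    ‖q.2 - q'.2‖ ≤ dEnc Enc q q' := by
  refine (sq_le_sq₀ (norm_nonneg _) (norm_nonneg _)).1 ?_
  change _ ≤ dEnc Enc q q' ^ 2
  rw [dEnc_sq]
  exact le_add_of_nonneg_left (sq_nonneg _)

lemma dEnc_eq_norm_label_sub_iff (q q' : E × EuclideanSpace ℝ (Fin l)) :
    dEnc Enc q q' = ‖q.2 - q'.2‖ ↔ Enc q.1 q.2 = Enc q'.1 q'.2 := by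
  have hd : 0 ≤ dEnc Enc q q' := norm_nonneg _
  rw [← sq_eq_sq₀ hd (norm_nonneg _), dEnc_sq, add_eq_right, sq_eq_zero_iff, norm_eq_zero,
    sub_eq_zero]

variable [MeasurableSpace E] {κ : Kernel (EuclideanSpace ℝ (Fin l)) E}
  {𝒳 : Set E} {𝒵 : Set (EuclideanSpace ℝ (Fin k))} {𝒞 : Set (EuclideanSpace ℝ (Fin l))}
  {c c' : EuclideanSpace ℝ (Fin l)}

/-- If the representation has the same law for the labels `c` and `c'`, then decoding with `c'`
the representation of data labelled `c` produces data with the conditional law for `c'`. -/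
lemma hasLaw_gen_enc (hEnc : Measurable (Function.uncurry Enc))
    (hGen : Measurable (Function.uncurry Gen)) (hA1 : OneToOne 𝒳 𝒵 𝒞 Enc Gen)
    (hc' : c' ∈ 𝒞) (h𝒳 : ∀ᵐ x ∂(κ c'), x ∈ 𝒳) (hlaw : encLaw Enc κ c = encLaw Enc κ c') :
    HasLaw (fun x => Gen (Enc x c) c') (κ c') (κ c) := by
  have hE (b : EuclideanSpace ℝ (Fin l)) : Measurable fun x => Enc x b := hEnc.of_uncurry_right
  have hG : Measurable fun z => Gen z c' := hGen.of_uncurry_right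
  refine ⟨(hG.comp (hE c)).aemeasurable, ?_⟩
  calc (κ c).map (fun x => Gen (Enc x c) c')
      = (encLaw Enc κ c).map fun z => Gen z c' := (Measure.map_map hG (hE c)).symm
    _ = (encLaw Enc κ c').map fun z => Gen z c' := by rw [hlaw]
    _ = (κ c').map fun x => Gen (Enc x c') c' := Measure.map_map hG (hE c')
    _ = (κ c').map id :=
        Measure.map_congr (h𝒳.mono fun x hx => hA1.gen_enc c' hc' x hx)
    _ = κ c' := Measure.map_id

lemma aemeasurable_dEnc_rpow {A : Type*} [MeasurableSpace A] {μ : Measure A}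
    {f g : A → E × EuclideanSpace ℝ (Fin l)} (hEnc : Measurable (Function.uncurry Enc)) (p : ℝ)
    (hf : AEMeasurable f μ) (hg : AEMeasurable g μ) :
    AEMeasurable (fun a => ENNReal.ofReal (dEnc Enc (f a) (g a) ^ p)) μ := by
  have h : Measurable fun q : E × EuclideanSpace ℝ (Fin l) => WithLp.toLp 2 (Enc q.1 q.2, q.2) :=
    (WithLp.measurable_toLp 2 _).comp (hEnc.prodMk measurable_snd)
  exact (((h.comp_aemeasurable hf).sub (h.comp_aemeasurable hg)).norm.pow_const p).ennreal_ofReal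

lemma lintegral_dEnc_jointLaw (hEnc : Measurable (Function.uncurry Enc)) (p : ℝ)
    {S : E × EuclideanSpace ℝ (Fin l) → E × EuclideanSpace ℝ (Fin l)}
    (hS : AEMeasurable S (jointLaw κ c)) :
    ∫⁻ q, ENNReal.ofReal (dEnc Enc q (S q) ^ p) ∂(jointLaw κ c)
      = ∫⁻ x, ENNReal.ofReal (dEnc Enc (x, c) (S (x, c)) ^ p) ∂(κ c) := by
  have hm := aemeasurable_dEnc_rpow hEnc p aemeasurable_id' hS
  unfold jointLaw at hm ⊢
  exact lintegral_map' hm measurable_prodMk_right.aemeasurable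

/-- Between labels with the same law of the representation, an optimal transport map for a power
of `d_Enc` leaves the representation unchanged almost surely. -/
lemma ae_enc_transport_eq [IsMarkovKernel κ] {p : ℝ} (hp : 0 < p)
    (hEnc : Measurable (Function.uncurry Enc))
    (hGen : Measurable (Function.uncurry Gen)) (hA1 : OneToOne 𝒳 𝒵 𝒞 Enc Gen)
    (hc : c ∈ 𝒞) (hc' : c' ∈ 𝒞) (h𝒳 : ∀ᵐ x ∂(κ c), x ∈ 𝒳) (h𝒳' : ∀ᵐ x ∂(κ c'), x ∈ 𝒳)
    (hlaw : encLaw Enc κ c = encLaw Enc κ c')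
    {S : E × EuclideanSpace ℝ (Fin l) → E}
    (hS : IsOptimalTransportMap (fun q q' => ENNReal.ofReal (dEnc Enc q q' ^ p))
      (jointLaw κ c) (jointLaw κ c') (fun q => (S q, c'))) :
    ∀ᵐ x ∂(κ c), Enc (S (x, c)) c' = Enc x c := by
  have hE : Measurable fun x => Enc x c := hEnc.of_uncurry_right
  have hG : Measurable fun z => Gen z c' := hGen.of_uncurry_right
  have hST : AEMeasurable (fun x => (S (x, c), c')) (κ c) :=
    hS.1.aemeasurable.comp_aemeasurable measurable_prodMk_right.aemeasurable
  -- The competitor: change the label and keep the representation.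
  let R : E × EuclideanSpace ℝ (Fin l) → E × EuclideanSpace ℝ (Fin l) :=
    fun q => (Gen (Enc q.1 c) c', c')
  have hRm : Measurable R := ((hG.comp hE).comp measurable_fst).prodMk measurable_const
  have hRlaw : HasLaw R (jointLaw κ c') (jointLaw κ c) := by
    refine ⟨hRm.aemeasurable, ?_⟩
    calc (jointLaw κ c).map R
        = (κ c).map fun x => (Gen (Enc x c) c', c') :=
          Measure.map_map hRm measurable_prodMk_right
      _ = ((κ c).map fun x => Gen (Enc x c) c').map fun x => (x, c') :=
          (Measure.map_map measurable_prodMk_right (hG.comp hE)).symm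
      _ = jointLaw κ c' := by
          rw [(hasLaw_gen_enc hEnc hGen hA1 hc' h𝒳' hlaw).map_eq, jointLaw]
  have hRcost : ∫⁻ q, ENNReal.ofReal (dEnc Enc q (R q) ^ p) ∂(jointLaw κ c)
      = ENNReal.ofReal (‖c - c'‖ ^ p) := by
    rw [lintegral_dEnc_jointLaw hEnc p hRm.aemeasurable,
      lintegral_congr_ae (g := fun _ => ENNReal.ofReal (‖c - c'‖ ^ p)), lintegral_const,
      measure_univ, mul_one]
    filter_upwards [h𝒳] with x hx
    have hd : dEnc Enc (x, c) (R (x, c)) = ‖c - c'‖ :=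
      (dEnc_eq_norm_label_sub_iff (x, c) (R (x, c))).2
        (hA1.enc_gen c' hc' _ (hA1.enc_mem c hc x hx)).symm
    rw [hd]
  have hScost : ∫⁻ x, ENNReal.ofReal (dEnc Enc (x, c) (S (x, c), c') ^ p) ∂(κ c)
      ≤ ENNReal.ofReal (‖c - c'‖ ^ p) := by
    rw [← hRcost, ← lintegral_dEnc_jointLaw hEnc p hS.1.aemeasurable]
    exact hS.2 R hRlaw
  -- The cost is pointwise at least `‖c - c'‖ ^ p`, so it equals that constant almost surely.
  have hae := ae_eq_of_ae_le_of_lintegral_le (μ := κ c)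
    (f := fun _ => ENNReal.ofReal (‖c - c'‖ ^ p))
    (g := fun x => ENNReal.ofReal (dEnc Enc (x, c) (S (x, c), c') ^ p))
    (.of_forall fun x => ENNReal.ofReal_le_ofReal <| Real.rpow_le_rpow (norm_nonneg _)
      (norm_label_sub_le_dEnc (x, c) (S (x, c), c')) hp.le)
    (by simp) (aemeasurable_dEnc_rpow hEnc p measurable_prodMk_right.aemeasurable hST)
    (by simpa using hScost)
  filter_upwards [hae] with x hx
  have hd : 0 ≤ dEnc Enc (x, c) (S (x, c), c') := norm_nonneg _
  rw [ENNReal.ofReal_eq_ofReal_iff (by positivity) (by positivity),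
    Real.rpow_left_inj (norm_nonneg _) hd hp.ne'] at hx
  exact ((dEnc_eq_norm_label_sub_iff (x, c) (S (x, c), c')).1 hx.symm).symm

end GeodesicGenerator

open GeodesicGenerator in
theorem theorem5 {Ω Ω' E : Type*} [MeasurableSpace Ω] [MeasurableSpace Ω'] [MeasurableSpace E]
    {k l M : ℕ} [NeZero M]
    (P : Measure Ω) [IsProbabilityMeasure P]
    (X : Ω → E) (C : Ω → EuclideanSpace ℝ (Fin l))
    (𝒳 : Set E) (𝒵 : Set (EuclideanSpace ℝ (Fin k))) (𝒞 : Set (EuclideanSpace ℝ (Fin l)))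
    (κ : Kernel (EuclideanSpace ℝ (Fin l)) E) [IsMarkovKernel κ]
    (hκ : IsConditionalLaw P X C 𝒳 𝒞 κ)
    (Enc : E → EuclideanSpace ℝ (Fin l) → EuclideanSpace ℝ (Fin k))
    (Gen : EuclideanSpace ℝ (Fin k) → EuclideanSpace ℝ (Fin l) → E)
    (T : E → EuclideanSpace ℝ (Fin l) → EuclideanSpace ℝ (Fin l) → E)
    (hEnc : Measurable (Function.uncurry Enc)) (hGen : Measurable (Function.uncurry Gen))
    (p : ℝ) (hp : 1 ≤ p)
    (c : Fin M → EuclideanSpace ℝ (Fin l)) (hc : ∀ m, c m ∈ 𝒞)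
    (α : Fin M → ℝ) (hα : ∀ m, 0 ≤ α m) (hα_sum : ∑ m, α m = 1)
    (hc_bar : ∑ m, α m • c m ∈ 𝒞)
    (hA1 : OneToOne 𝒳 𝒵 𝒞 Enc Gen)
    (hA2 : AbsolutelyContinuousRepresentations 𝒞 Enc κ)
    (hA3 : OptimalTransportation p c Enc T κ)
    (hA4 : HomogeneousOnObserved c Enc κ)
    (hA5 : Homogeneous 𝒞 Enc κ)
    (P' : Measure Ω') [IsProbabilityMeasure P']
    (X₁ : Ω' → E) (hX₁ : HasLaw X₁ (κ (c 0)) P') :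
    HasLaw (fun ω => latentInterpolation α c Enc Gen T (X₁ ω)) (κ (∑ m, α m • c m)) P' := by
  have h𝒳 := hκ.data_mem
  have hlaw := hasLaw_gen_enc hEnc hGen hA1 hc_bar (h𝒳 _ hc_bar) (hA5 (c 0) (hc 0) _ hc_bar)
  have hT : ∀ᵐ x ∂(κ (c 0)), ∀ m, Enc (T x (c 0) (c m)) (c m) = Enc x (c 0) :=
    ae_all_iff.2 fun m => ae_enc_transport_eq (S := fun q => T q.1 q.2 (c m))
      (zero_lt_one.trans_le hp) hEnc hGen hA1 (hc 0) (hc m) (h𝒳 _ (hc 0)) (h𝒳 _ (hc m))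
      (hA4 0 m) (hA3 0 m)
  have hinterp : latentInterpolation α c Enc Gen T
      =ᵐ[κ (c 0)] fun x => Gen (Enc x (c 0)) (∑ m, α m • c m) := by
    filter_upwards [hT] with x hx
    simp only [latentInterpolation, hx]
    rw [← Finset.sum_smul, hα_sum, one_smul]
  exact (hlaw.congr hinterp).comp hX₁
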